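/- Let $(N_n)_{n\ge1}$ be a sequence of positive real numbers and $(B_n)_{n\ge1}$ a sequence of finite subsets of $\mathbb{R}$ with $\#B_n\ge 2$ for all $n$. For a nonempty finite set $A\subseteq\mathbb{R}$ let $\delta_A=\frac1{\#A}\sum_{a\in A}\delta_a$, where $\delta_a$ is the Dirac measure at $a$, and put $$\mu_n=\delta_{N_1^{-1}B_1}*\delta_{(N_1N_2)^{-1}B_2}*\cdots*\delta_{(N_1N_2\cdots N_n)^{-1}B_n}.$$ We say that the infinite convolution of $\{(N_n,B_n)\}_{n\ge1}$ exists if $(\mu_n)$ converges weakly to a Borel probability measure on $\mathbb{R}$. Let $B_{n,2}$ be the set of those $b\in B_n$ that are not integers with $0\le b\le N_n-1$, i.e. $B_{n,2}=B_n\setminus\{0,1,\ldots,N_n-1\}$. (a) If the remainder bounded condition (RBC) $$\sum_{n=1}^\infty\frac{\#B_{n,2}}{\#B_n}<\infty$$ holds, or if $$\sum_{n=1}^\infty\frac{\max\{|b|:b\in B_n\}}{N_1N_2\cdots N_n}<\infty,$$ then the infinite convolution exists. (b) If there is $r_0>0$ such that $$\sum_{n=1}^\infty\frac{\#\{b\in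 B_n:|b|>N_1N_2\cdots N_n\,r_0\}}{\#B_n}=\infty,$$ then the infinite convolution does not exist. -/

import Mathlib

open MeasureTheory Filter
open scoped Topology ENNReal NNReal

/-- The uniform discrete measure `δ_A = (1 / #A) ∑_{a ∈ A} δ_a` on a finite set `A ⊆ ℝ`. -/
noncomputable def uniformDiscrete (A : Finset ℝ) : Measure ℝ :=
  (A.card : ℝ≥0∞)⁻¹ • ∑ a ∈ A, Measure.dirac a

theorem isProbabilityMeasure_uniformDiscrete {A : Finset ℝ} (hA : A.Nonempty) :
    IsProbabilityMeasure (uniformDiscrete A) := by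
  constructor
  simp only [uniformDiscrete, Measure.smul_apply, Measure.coe_finsetSum, Finset.sum_apply,
    measure_univ, Finset.sum_const, nsmul_eq_mul, mul_one, smul_eq_mul]
  exact ENNReal.inv_mul_cancel (by exact_mod_cast hA.card_pos.ne') (ENNReal.natCast_ne_top _)

/-- Sequences are indexed from `0`: the values `N n`, `B n` are the terms `N_{n+1}`, `B_{n+1}` of
the sequence `(N_1, B_1), (N_2, B_2), …`. So this is the product `N_1 N_2 ⋯ N_{n+1}`. -/
noncomputable def scaleProd (N : ℕ → ℝ) (n : ℕ) : ℝ := ∏ i ∈ Finset.range (n + 1), N i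

/-- The factor `δ_{(N_1 ⋯ N_{n+1})⁻¹ B_{n+1}}`. -/
noncomputable def convFactor (N : ℕ → ℝ) (B : ℕ → Finset ℝ) (n : ℕ) : Measure ℝ :=
  uniformDiscrete ((B n).image fun b => (scaleProd N n)⁻¹ * b)

/-- The convolution `μ_n = δ_{N_1⁻¹ B_1} * ⋯ * δ_{(N_1 ⋯ N_n)⁻¹ B_n}` of the first `n` factors
(for `n = 0` the empty convolution `δ_0`, the unit for convolution). -/
noncomputable def partialConv (N : ℕ → ℝ) (B : ℕ → Finset ℝ) : ℕ → Measure ℝ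
  | 0 => Measure.dirac 0
  | n + 1 => Measure.conv (partialConv N B n) (convFactor N B n)

theorem isProbabilityMeasure_partialConv (N : ℕ → ℝ) (B : ℕ → Finset ℝ)
    (hB : ∀ n, 2 ≤ (B n).card) (n : ℕ) : IsProbabilityMeasure (partialConv N B n) := by
  induction n with
  | zero => simp only [partialConv]; infer_instance
  | succ n ih =>
    have h : (B n).Nonempty := Finset.card_pos.1 (by have := hB n; omega)
    have : IsProbabilityMeasure (convFactor N B n) :=
      isProbabilityMeasure_uniformDiscrete (h.image _)
    simp only [partialConv]
    infer_instance

/-- `μ_n` as an element of the space of Borel probability measures on `ℝ`, which Mathlib equips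
with the topology of weak convergence. -/
noncomputable def partialConvProb (N : ℕ → ℝ) (B : ℕ → Finset ℝ)
    (hB : ∀ n, 2 ≤ (B n).card) (n : ℕ) : ProbabilityMeasure ℝ :=
  ⟨partialConv N B n, isProbabilityMeasure_partialConv N B hB n⟩

/-- The infinite convolution of `(N_n, B_n)` exists: `μ_n` converges weakly to a Borel
probability measure. -/
def InfiniteConvolutionExists (N : ℕ → ℝ) (B : ℕ → Finset ℝ) (hB : ∀ n, 2 ≤ (B n).card) : Prop :=
  ∃ μ : ProbabilityMeasure ℝ, Tendsto (partialConvProb N B hB) atTop (𝓝 μ)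

open Classical in
/-- `B ∩ {0, 1, …, M - 1}`; for real `M` the set `{0, 1, …, M - 1}` consists of the integers `k`
with `0 ≤ k ≤ M - 1` (it is empty if `M < 1`). -/
noncomputable def mainDigits (M : ℝ) (B : Finset ℝ) : Finset ℝ :=
  B.filter fun b => ∃ k : ℕ, (k : ℝ) ≤ M - 1 ∧ b = k

/-- `B \ {0, 1, …, M - 1}`. -/
noncomputable def remainderDigits (M : ℝ) (B : Finset ℝ) : Finset ℝ :=
  B \ mainDigits M B

/-- The remainder bounded condition `∑ #B_{n,2} / #B_n < ∞`. -/
def RemainderBounded (N : ℕ → ℝ) (B : ℕ → Finset ℝ) : Prop :=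
  Summable fun n => ((remainderDigits (N n) (B n)).card : ℝ) / ((B n).card : ℝ)

/-- `max {|b| : b ∈ B}` for a nonempty finite set `B ⊆ ℝ`. -/
noncomputable def maxAbs (B : Finset ℝ) : ℝ := ((B.sup fun b => ‖b‖₊ : ℝ≥0) : ℝ)

/-- `{b ∈ B : |b| > t}`. -/
noncomputable def largeDigits (t : ℝ) (B : Finset ℝ) : Finset ℝ := B.filter fun b => t < |b|

/-!
Let `X_k` be independent with laws `ν_k = convFactor N B k`, so that `partialConv N B n` is the law
of `X_0 + ⋯ + X_{n-1}`. The probability that `|X_k| > r` is the proportion of digits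
`b ∈ B k` with `|b| > r * scaleProd N k` (`convFactor_real_tail`), so both parts are instances of
statements about sums of independent variables.

Existence: if `∑ c_k` and `∑ P(|X_k| > c_k)` converge, then `∑ X_k` converges almost surely by
Borel–Cantelli, hence in distribution (`exists_tendsto_of_summable_tails`). For the second
condition take `c_k` to be the maximum of `|X_k|`. For the remainder bounded condition take
`c_k = N k / scaleProd N k`: only remainder digits exceed `N k`, and since more than half of the
digits are eventually main digits, `N k ≥ 2` eventually and `∑ c_k` is dominated by a geometric
series.

Non-existence: if the laws converge weakly, then `∑ P(|X_k| > r)` converges for every `r > 0`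
(`summable_tails_of_tendsto`). The characteristic functions `f_k` of `ν_k` have a product whose
partial products have modulus bounded below near `0`, so `∑ (1 - |f_k| ^ 2)` is bounded there. As
`|f_k| ^ 2` is the characteristic function of `X_k - X_k'`, with `X_k'` an independent copy of
`X_k`, the inequality `1 - cos 2u ≤ 4 (1 - cos u)` spreads the bound to all bounded intervals, and
integration bounds `∑ P(|X_k - X_k'| > r / 2)`. Finally `X_k → 0` in probability removes the
symmetrization.
-/

/-! ### Almost sure convergence of independent sums -/

/-- Coordinates of the infinite product are independent, so their partial sums have as laws the
successive convolutions. -/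
theorem map_sum_infinitePi_eq {ν μ : ℕ → Measure ℝ} [∀ n, IsProbabilityMeasure (ν n)]
    (h0 : μ 0 = Measure.dirac 0) (hμ : ∀ n, μ (n + 1) = (μ n).conv (ν n)) (n : ℕ) :
    (Measure.infinitePi ν).map (fun ω => ∑ k ∈ Finset.range n, ω k) = μ n := by
  induction n with
  | zero => simp [h0]
  | succ n ih =>
    have hind : ProbabilityTheory.iIndepFun (fun (i : ℕ) (ω : ℕ → ℝ) => ω i)
        (Measure.infinitePi ν) :=
      ProbabilityTheory.iIndepFun_infinitePi (X := fun _ x => x) (fun _ => measurable_id)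
    have h := hind.indepFun_sum_range_succ (fun i => measurable_pi_apply i) n
    have hs : (∑ j ∈ Finset.range n, fun ω : ℕ → ℝ => ω j) =
        fun ω => ∑ k ∈ Finset.range n, ω k := by
      ext ω; simp
    rw [hs] at h
    have h2 := h.map_add_eq_map_conv_map (by fun_prop) (by fun_prop)
    rw [ih, Measure.infinitePi_map_eval ν n, ← hμ n] at h2
    rw [← h2]
    congr 1
    ext ω
    simp [Finset.sum_range_succ]

/-- A weak form of Kolmogorov's three-series criterion: by Borel–Cantelli, the partial sums of
independent variables with laws `ν n` converge almost surely, hence in distribution. -/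
theorem exists_tendsto_of_summable_tails {ν : ℕ → Measure ℝ} [∀ n, IsProbabilityMeasure (ν n)]
    {μ : ℕ → ProbabilityMeasure ℝ} (h0 : (μ 0 : Measure ℝ) = Measure.dirac 0)
    (hμ : ∀ n, (μ (n + 1) : Measure ℝ) = (μ n : Measure ℝ).conv (ν n))
    {c : ℕ → ℝ} (hc : Summable c) (hν : Summable fun n => (ν n).real {x | c n < |x|}) :
    ∃ μ' : ProbabilityMeasure ℝ, Tendsto μ atTop (𝓝 μ') := by
  set P := Measure.infinitePi ν
  have hlaw := map_sum_infinitePi_eq (μ := fun n => (μ n : Measure ℝ)) h0 hμ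
  have hP : ∀ n, P {ω | c n < |ω n|} = ENNReal.ofReal ((ν n).real {x | c n < |x|}) := by
    intro n
    rw [ofReal_measureReal, ← Measure.infinitePi_map_eval ν n,
      Measure.map_apply (by fun_prop) (measurableSet_lt measurable_const (by fun_prop))]
    rfl
  have hsum : ∑' n, P {ω | c n < |ω n|} ≠ ∞ := by
    simp_rw [hP]
    exact hν.tsum_ofReal_ne_top
  have hae : ∀ᵐ ω ∂P, ∃ l, Tendsto (fun n => ∑ k ∈ Finset.range n, ω k) atTop (𝓝 l) := by
    filter_upwards [ae_eventually_notMem hsum] with ω hω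
    have : Summable ω := by
      refine Summable.of_norm_bounded_eventually_nat hc ?_
      filter_upwards [hω] with n hn
      simpa using hn
    exact ⟨_, this.hasSum.tendsto_sum_nat⟩
  obtain ⟨X, hX, hlim⟩ := measurable_limit_of_tendsto_metrizable_ae
    (f := fun n (ω : ℕ → ℝ) => ∑ k ∈ Finset.range n, ω k) (L := atTop)
    (fun n => by fun_prop) hae
  let μ' : ProbabilityMeasure ℝ := ⟨P.map X, Measure.isProbabilityMeasure_map hX.aemeasurable⟩
  refine ⟨μ', ProbabilityMeasure.tendsto_iff_forall_integral_tendsto.2 ?_⟩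
  intro g
  change Tendsto _ _ (𝓝 (∫ x, g x ∂(P.map X)))
  rw [integral_map hX.aemeasurable g.continuous.aestronglyMeasurable]
  have hg : ∀ n, ∫ x, g x ∂(μ n : Measure ℝ) =
      ∫ ω, g (∑ k ∈ Finset.range n, ω k) ∂P := fun n => by
    rw [← hlaw n, integral_map (by fun_prop) g.continuous.aestronglyMeasurable]
  simp_rw [hg]
  refine tendsto_integral_of_dominated_convergence (fun _ => ‖g‖)
    (fun n => (g.continuous.measurable.comp (by fun_prop)).aestronglyMeasurable)
    (integrable_const _) (fun n => ae_of_all _ fun ω => g.norm_coe_le_norm _) ?_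
  filter_upwards [hlim] with ω hω
  exact (g.continuous.tendsto _).comp hω

/-! ### Symmetrization and characteristic functions -/

/-- From `1 - cos 2u ≤ 4 (1 - cos u)`. -/
theorem one_sub_re_charFun_two_mul_le (ν : Measure ℝ) [IsProbabilityMeasure ν] (t : ℝ) :
    1 - (charFun ν (2 * t)).re ≤ 4 * (1 - (charFun ν t).re) := by
  have hint : ∀ s : ℝ, Integrable (fun x => Real.cos (s * x)) ν := fun s =>
    Integrable.of_bound (C := 1) (by fun_prop)
      (ae_of_all _ fun x => by simpa using Real.abs_cos_le_one _)
  have hre : ∀ s : ℝ, 1 - (charFun ν s).re = ∫ x, (1 - Real.cos (s * x)) ∂ν := fun s => by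
    rw [integral_sub (integrable_const _) (hint s), charFun_apply_real,
      ← RCLike.re_eq_complex_re, ← integral_re]
    · simp only [integral_const, probReal_univ, smul_eq_mul, mul_one, RCLike.re_eq_complex_re]
      congr 2
      ext x
      rw [← Complex.ofReal_mul, Complex.exp_ofReal_mul_I_re]
    · refine Integrable.of_bound (C := 1) (by fun_prop) (ae_of_all _ fun x => ?_)
      rw [← Complex.ofReal_mul, Complex.norm_exp_ofReal_mul_I]
  rw [hre, hre, ← integral_const_mul]
  refine integral_mono ((integrable_const _).sub (hint _))
    (((integrable_const _).sub (hint _)).const_mul _) fun x => ?_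
  simp only [mul_assoc, Real.cos_two_mul]
  nlinarith [sq_nonneg (Real.cos (t * x) - 1)]

/-- The law of `X - X'` for independent `X`, `X'` with law `ν`. -/
noncomputable def symmetrization (ν : Measure ℝ) : Measure ℝ := ν.conv (ν.map Neg.neg)

instance (ν : Measure ℝ) [IsProbabilityMeasure ν] : IsProbabilityMeasure (symmetrization ν) := by
  have := Measure.isProbabilityMeasure_map (μ := ν) measurable_neg.aemeasurable
  unfold symmetrization
  infer_instance

theorem charFun_symmetrization (ν : Measure ℝ) [IsProbabilityMeasure ν] (t : ℝ) :
    charFun (symmetrization ν) t = Complex.normSq (charFun ν t) := by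
  have := Measure.isProbabilityMeasure_map (μ := ν) measurable_neg.aemeasurable
  have h : charFun (ν.map Neg.neg) t = charFun ν (-t) := by
    have := charFun_map_mul (μ := ν) (-1) t
    simpa using this
  rw [symmetrization, charFun_conv, h, charFun_neg, Complex.mul_conj]

/-- `|X| > r` and `|X'| ≤ r / 2` force `|X - X'| > r / 2`. -/
theorem real_mul_real_le_symmetrization (ν : Measure ℝ) [IsProbabilityMeasure ν] (r : ℝ) :
    ν.real {x | r < |x|} * ν.real {x | |x| ≤ r / 2} ≤
      (symmetrization ν).real {x | r / 2 < |x|} := by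
  have hm : MeasurableSet {x : ℝ | r / 2 < |x|} :=
    measurableSet_lt measurable_const (by fun_prop)
  have := Measure.isProbabilityMeasure_map (μ := ν) measurable_neg.aemeasurable
  have hneg : ν.real {x | |x| ≤ r / 2} = (ν.map Neg.neg).real {x | |x| ≤ r / 2} := by
    rw [map_measureReal_apply measurable_neg (measurableSet_le (by fun_prop) measurable_const)]
    simp
  rw [hneg, ← measureReal_prod_prod, symmetrization, Measure.conv,
    map_measureReal_apply (by fun_prop) hm]
  refine measureReal_mono ?_
  rintro ⟨x, y⟩ ⟨hx, hy⟩
  simp only [Set.mem_ofPred_eq, Set.mem_preimage] at *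
  have := abs_sub_abs_le_abs_sub x (-y)
  rw [abs_neg, sub_neg_eq_add] at this
  linarith

/-! ### Characteristic functions of a convergent sequence of convolutions -/

theorem charFun_eq_prod {ν μ : ℕ → Measure ℝ} [∀ n, IsProbabilityMeasure (ν n)]
    [∀ n, IsProbabilityMeasure (μ n)] (h0 : μ 0 = Measure.dirac 0)
    (hμ : ∀ n, μ (n + 1) = (μ n).conv (ν n)) (n : ℕ) (t : ℝ) :
    charFun (μ n) t = ∏ k ∈ Finset.range n, charFun (ν k) t := by
  induction n with
  | zero => simp [h0, charFun_dirac]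
  | succ n ih => rw [hμ, charFun_conv, ih, Finset.prod_range_succ]

/-- Values far from `0` of a function with `h (2 t) ≤ 4 h t` are controlled by those near `0`. -/
theorem le_four_pow_mul_of_doubling {h : ℝ → ℝ} (h2 : ∀ t, h (2 * t) ≤ 4 * h t) (m : ℕ) (t : ℝ) :
    h t ≤ 4 ^ m * h (t / 2 ^ m) := by
  induction m with
  | zero => simp
  | succ m ih =>
    have := h2 (t / 2 ^ (m + 1))
    rw [show 2 * (t / 2 ^ (m + 1)) = t / 2 ^ m by rw [pow_succ]; field_simp] at this
    calc h t ≤ 4 ^ m * h (t / 2 ^ m) := ih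
      _ ≤ 4 ^ m * (4 * h (t / 2 ^ (m + 1))) := by gcongr
      _ = _ := by ring

theorem exists_abs_div_two_pow_le (R : ℝ) {T : ℝ} (hT : 0 < T) :
    ∃ m : ℕ, ∀ t, |t| ≤ R → |t / 2 ^ m| ≤ T := by
  obtain ⟨m, hm⟩ := pow_unbounded_of_one_lt (R / T) one_lt_two
  refine ⟨m, fun t ht => ?_⟩
  rw [div_lt_iff₀ hT] at hm
  rw [abs_div, abs_of_pos (by positivity : (0 : ℝ) < 2 ^ m), div_le_iff₀ (by positivity)]
  linarith

section Convergent

variable {ν : ℕ → Measure ℝ} [∀ n, IsProbabilityMeasure (ν n)]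
  {μ : ℕ → ProbabilityMeasure ℝ} {μ' : ProbabilityMeasure ℝ}

/-- Since `|φ_n| ^ 2` decreases to `|φ| ^ 2`, the limit bounds every term from below. -/
theorem normSq_charFun_limit_le (h0 : (μ 0 : Measure ℝ) = Measure.dirac 0)
    (hμ : ∀ n, (μ (n + 1) : Measure ℝ) = (μ n : Measure ℝ).conv (ν n))
    (hlim : Tendsto μ atTop (𝓝 μ')) (n : ℕ) (t : ℝ) :
    Complex.normSq (charFun (μ' : Measure ℝ) t) ≤
      ∏ k ∈ Finset.range n, Complex.normSq (charFun (ν k) t) := by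
  have hprod : ∀ n, Complex.normSq (charFun (μ n : Measure ℝ) t) =
      ∏ k ∈ Finset.range n, Complex.normSq (charFun (ν k) t) := fun n => by
    rw [charFun_eq_prod (μ := fun n => (μ n : Measure ℝ)) h0 hμ n t, map_prod]
  rw [← hprod]
  have hanti : Antitone fun n => Complex.normSq (charFun (μ n : Measure ℝ) t) := by
    refine antitone_nat_of_succ_le fun k => ?_
    rw [hprod, hprod, Finset.prod_range_succ]
    refine mul_le_of_le_one_right (Finset.prod_nonneg fun i _ => Complex.normSq_nonneg _) ?_
    rw [Complex.normSq_eq_norm_sq]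
    exact pow_le_one₀ (norm_nonneg _) (norm_charFun_le_one _)
  exact hanti.le_of_tendsto (((Complex.continuous_normSq.tendsto _).comp
    (ProbabilityMeasure.tendsto_iff_tendsto_charFun.1 hlim t))) n

theorem exists_one_half_le_normSq_charFun (ν : Measure ℝ) [IsProbabilityMeasure ν] :
    ∃ T > 0, ∀ t, |t| ≤ T → 1 / 2 ≤ Complex.normSq (charFun ν t) := by
  have hc : ContinuousAt (fun t => Complex.normSq (charFun ν t)) 0 :=
    (Complex.continuous_normSq.comp continuous_charFun).continuousAt
  have h1 : ∀ᶠ t in 𝓝 (0 : ℝ), 1 / 2 < Complex.normSq (charFun ν t) :=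
    hc.eventually (lt_mem_nhds (by norm_num [charFun_zero]))
  obtain ⟨T, hT, h⟩ := Metric.eventually_nhds_iff.1 h1
  refine ⟨T / 2, by positivity, fun t ht => (h ?_).le⟩
  rw [Real.dist_eq, sub_zero]
  linarith

/-- Weak convergence of the partial convolutions makes the tails of the symmetrized factors
summable: `∑ (1 - |f_k| ^ 2) ≤ - log ∏ |f_k| ^ 2` is bounded near `0`, hence by doubling on every
bounded interval. -/
theorem summable_symmetrization_tails (h0 : (μ 0 : Measure ℝ) = Measure.dirac 0)
    (hμ : ∀ n, (μ (n + 1) : Measure ℝ) = (μ n : Measure ℝ).conv (ν n))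
    (hlim : Tendsto μ atTop (𝓝 μ')) {r : ℝ} (hr : 0 < r) :
    Summable fun n => (symmetrization (ν n)).real {x | r < |x|} := by
  obtain ⟨T, hT, hhalf⟩ := exists_one_half_le_normSq_charFun (μ' : Measure ℝ)
  obtain ⟨m, hm⟩ := exists_abs_div_two_pow_le (2 * r⁻¹) hT
  set g : ℕ → ℝ → ℝ := fun k t => 1 - Complex.normSq (charFun (ν k) t)
  have hg0 : ∀ k t, 0 ≤ g k t := fun k t => by
    have : Complex.normSq (charFun (ν k) t) ≤ 1 := by
      rw [Complex.normSq_eq_norm_sq]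
      exact pow_le_one₀ (norm_nonneg _) (norm_charFun_le_one _)
    simpa [g] using this
  have hgc : ∀ k, Continuous (g k) := fun k =>
    continuous_const.sub (Complex.continuous_normSq.comp continuous_charFun)
  have hnear : ∀ n t, |t| ≤ T → ∑ k ∈ Finset.range n, g k t ≤ Real.log 2 := by
    intro n t ht
    have hprod : 1 / 2 ≤ ∏ k ∈ Finset.range n, Complex.normSq (charFun (ν k) t) :=
      (hhalf t ht).trans (normSq_charFun_limit_le h0 hμ hlim n t)
    have hne : ∀ k ∈ Finset.range n, Complex.normSq (charFun (ν k) t) ≠ 0 :=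
      Finset.prod_ne_zero_iff.1 (by linarith)
    calc ∑ k ∈ Finset.range n, g k t
        ≤ ∑ k ∈ Finset.range n, -Real.log (Complex.normSq (charFun (ν k) t)) := by
          refine Finset.sum_le_sum fun k hk => ?_
          have := Real.log_le_sub_one_of_pos
            ((Complex.normSq_nonneg (charFun (ν k) t)).lt_of_ne' (hne k hk))
          simp only [g]
          linarith
      _ = -Real.log (∏ k ∈ Finset.range n, Complex.normSq (charFun (ν k) t)) := by
          rw [Real.log_prod hne, Finset.sum_neg_distrib]
      _ ≤ -Real.log (1 / 2) := neg_le_neg (Real.log_le_log (by norm_num) hprod)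
      _ = Real.log 2 := by simp
  have hdouble : ∀ n t, ∑ k ∈ Finset.range n, g k (2 * t) ≤
      4 * ∑ k ∈ Finset.range n, g k t := fun n t => by
    rw [Finset.mul_sum]
    refine Finset.sum_le_sum fun k _ => ?_
    have := one_sub_re_charFun_two_mul_le (symmetrization (ν k)) t
    simpa only [charFun_symmetrization, Complex.ofReal_re] using this
  have hfar : ∀ n t, |t| ≤ 2 * r⁻¹ → ∑ k ∈ Finset.range n, g k t ≤ 4 ^ m * Real.log 2 :=
    fun n t ht => (le_four_pow_mul_of_doubling
      (h := fun t => ∑ k ∈ Finset.range n, g k t) (hdouble n) m t).trans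
      (mul_le_mul_of_nonneg_left (hnear n _ (hm t ht)) (by positivity))
  have hab : -2 * r⁻¹ ≤ 2 * r⁻¹ := by nlinarith [inv_pos.2 hr]
  have htail : ∀ k, (symmetrization (ν k)).real {x | r < |x|} ≤
      2⁻¹ * r * ∫ t in (-2 * r⁻¹)..(2 * r⁻¹), g k t := fun k => by
    refine (measureReal_abs_gt_le_integral_charFun hr).trans_eq ?_
    have : ∀ t, 1 - charFun (symmetrization (ν k)) t = ((g k t : ℝ) : ℂ) := fun t => by
      rw [charFun_symmetrization]; simp [g]
    simp_rw [this]
    rw [intervalIntegral.integral_ofReal, Complex.norm_real, Real.norm_eq_abs, abs_of_nonneg]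
    exact intervalIntegral.integral_nonneg hab fun t _ => hg0 k t
  refine summable_of_sum_range_le
    (c := 2⁻¹ * r * ∫ _ in (-2 * r⁻¹)..(2 * r⁻¹), 4 ^ m * Real.log 2)
    (fun _ => measureReal_nonneg) fun n => ?_
  calc ∑ k ∈ Finset.range n, (symmetrization (ν k)).real {x | r < |x|}
      ≤ ∑ k ∈ Finset.range n, 2⁻¹ * r * ∫ t in (-2 * r⁻¹)..(2 * r⁻¹), g k t :=
        Finset.sum_le_sum fun k _ => htail k
    _ = 2⁻¹ * r * ∫ t in (-2 * r⁻¹)..(2 * r⁻¹), ∑ k ∈ Finset.range n, g k t := by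
        rw [← Finset.mul_sum, intervalIntegral.integral_finsetSum
          fun k _ => (hgc k).intervalIntegrable _ _]
    _ ≤ _ := by
        refine mul_le_mul_of_nonneg_left ?_ (by positivity)
        refine intervalIntegral.integral_mono_on hab
          ((continuous_finsetSum _ fun k _ => hgc k).intervalIntegrable _ _)
          intervalIntegrable_const fun t ht => hfar n t ?_
        exact abs_le.2 ⟨by linarith [ht.1], ht.2⟩

/-- Near `0` the limit `φ` of `φ_n` has no zeros, so `f_n = φ_{n+1} / φ_n → 1` there, and by
doubling everywhere. By Lévy's theorem the factors then converge weakly to `δ_0`. -/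
theorem tendsto_charFun_factor
    (hμ : ∀ n, (μ (n + 1) : Measure ℝ) = (μ n : Measure ℝ).conv (ν n))
    (hlim : Tendsto μ atTop (𝓝 μ')) (t : ℝ) :
    Tendsto (fun n => charFun (ν n) t) atTop (𝓝 1) := by
  obtain ⟨T, hT, hhalf⟩ := exists_one_half_le_normSq_charFun (μ' : Measure ℝ)
  obtain ⟨m, hm⟩ := exists_abs_div_two_pow_le |t| hT
  set s := t / 2 ^ m
  have hφ : charFun (μ' : Measure ℝ) s ≠ 0 := fun h => by
    have := hhalf s (hm t le_rfl)
    norm_num [h] at this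
  have hconv := ProbabilityMeasure.tendsto_iff_tendsto_charFun.1 hlim s
  have hs : Tendsto (fun n => charFun (ν n) s) atTop (𝓝 1) := by
    have hdiv := ((tendsto_add_atTop_iff_nat 1).2 hconv).div hconv hφ
    rw [div_self hφ] at hdiv
    refine hdiv.congr' ?_
    filter_upwards [hconv.eventually_ne hφ] with n hn
    simp only [Pi.div_apply]
    rw [hμ, charFun_conv, mul_div_cancel_left₀ _ hn]
  have hle : ∀ n, 1 - (charFun (ν n) t).re ≤ 4 ^ m * (1 - (charFun (ν n) s).re) := fun n =>
    le_four_pow_mul_of_doubling (h := fun t => 1 - (charFun (ν n) t).re)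
      (one_sub_re_charFun_two_mul_le (ν n)) m t
  -- `|1 - z| ^ 2 ≤ 2 (1 - Re z)` for `|z| ≤ 1`
  have hsq : ∀ n, ‖charFun (ν n) t - 1‖ ^ 2 ≤ 2 * (4 ^ m * (1 - (charFun (ν n) s).re)) := by
    intro n
    have h1 : Complex.normSq (charFun (ν n) t) ≤ 1 := by
      rw [Complex.normSq_eq_norm_sq]
      exact pow_le_one₀ (norm_nonneg _) (norm_charFun_le_one _)
    rw [← Complex.normSq_eq_norm_sq]
    have := hle n
    rw [Complex.normSq_apply] at h1 ⊢
    simp only [Complex.sub_re, Complex.sub_im, Complex.one_re, Complex.one_im]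
    nlinarith
  have hre : Tendsto (fun n => 2 * (4 ^ m * (1 - (charFun (ν n) s).re))) atTop (𝓝 0) := by
    have := ((Complex.continuous_re.tendsto _).comp hs).const_sub 1
    simpa using (this.const_mul (4 ^ m)).const_mul 2
  have hz := squeeze_zero (fun n => by positivity) hsq hre
  rw [tendsto_iff_norm_sub_tendsto_zero]
  have := (Real.continuous_sqrt.tendsto 0).comp hz
  simpa [Function.comp_def, Real.sqrt_sq] using this

theorem tendsto_factor_closedBall
    (hμ : ∀ n, (μ (n + 1) : Measure ℝ) = (μ n : Measure ℝ).conv (ν n))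
    (hlim : Tendsto μ atTop (𝓝 μ')) {r : ℝ} (hr : 0 < r) :
    Tendsto (fun n => (ν n).real {x | |x| ≤ r}) atTop (𝓝 1) := by
  let d : ProbabilityMeasure ℝ := ⟨Measure.dirac 0, inferInstance⟩
  let p : ℕ → ProbabilityMeasure ℝ := fun n => ⟨ν n, inferInstance⟩
  have hp : Tendsto p atTop (𝓝 d) := ProbabilityMeasure.tendsto_iff_tendsto_charFun.2 fun t => by
    change Tendsto (fun n => charFun (ν n) t) atTop (𝓝 (charFun (Measure.dirac 0) t))
    simpa [charFun_dirac] using tendsto_charFun_factor hμ hlim t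
  have hset : {x : ℝ | |x| ≤ r} = Metric.closedBall 0 r := by
    ext x; simp
  have hfr : (d : Measure ℝ) (frontier (Metric.closedBall 0 r)) = 0 := by
    change Measure.dirac 0 _ = _
    rw [Measure.dirac_apply' _ isClosed_frontier.measurableSet, frontier_closedBall _ hr.ne']
    simp [hr.ne]
  have h := ProbabilityMeasure.tendsto_measure_of_null_frontier_of_tendsto' hp hfr
  have h1 : (d : Measure ℝ) (Metric.closedBall 0 r) = 1 := by
    change Measure.dirac 0 _ = _
    rw [Measure.dirac_apply' _ measurableSet_closedBall]
    simp [hr.le]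
  rw [h1] at h
  rw [hset]
  exact (ENNReal.tendsto_toReal ENNReal.one_ne_top).comp h

/-- The necessary half of the three-series criterion used here: if the partial convolutions
converge weakly, the tails of the factors are summable. -/
theorem summable_tails_of_tendsto (h0 : (μ 0 : Measure ℝ) = Measure.dirac 0)
    (hμ : ∀ n, (μ (n + 1) : Measure ℝ) = (μ n : Measure ℝ).conv (ν n))
    (hlim : Tendsto μ atTop (𝓝 μ')) {r : ℝ} (hr : 0 < r) :
    Summable fun n => (ν n).real {x | r < |x|} := by
  have hsum := (summable_symmetrization_tails h0 hμ hlim (half_pos hr)).mul_left 2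
  refine Summable.of_norm_bounded_eventually_nat hsum ?_
  filter_upwards [(tendsto_factor_closedBall hμ hlim (half_pos hr)).eventually
    (lt_mem_nhds (by norm_num : (1 / 2 : ℝ) < 1))] with n hn
  rw [Real.norm_of_nonneg measureReal_nonneg]
  have := real_mul_real_le_symmetrization (ν n) r
  have h2 : 0 ≤ (ν n).real {x | r < |x|} := measureReal_nonneg
  nlinarith

end Convergent

/-! ### Tails of the discrete factors -/

theorem scaleProd_pos {N : ℕ → ℝ} (hN : ∀ n, 0 < N n) (n : ℕ) : 0 < scaleProd N n :=
  Finset.prod_pos fun i _ => hN i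

theorem scaleProd_succ (N : ℕ → ℝ) (n : ℕ) : scaleProd N (n + 1) = scaleProd N n * N (n + 1) :=
  Finset.prod_range_succ _ _

theorem uniformDiscrete_real (A : Finset ℝ) (p : ℝ → Prop) [DecidablePred p]
    (hp : MeasurableSet {x | p x}) :
    (uniformDiscrete A).real {x | p x} = ((A.filter p).card : ℝ) / (A.card : ℝ) := by
  have h : ∑ a ∈ A, Measure.dirac a {x | p x} = (A.filter p).card := by
    simp_rw [Measure.dirac_apply' _ hp, Set.indicator_apply]
    simp
  rw [measureReal_def, uniformDiscrete, Measure.smul_apply, Measure.coe_finsetSum,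
    Finset.sum_apply, h, smul_eq_mul, ENNReal.toReal_mul, ENNReal.toReal_inv]
  simp [div_eq_inv_mul]

theorem convFactor_real_tail {N : ℕ → ℝ} (hN : ∀ n, 0 < N n) (B : ℕ → Finset ℝ) (n : ℕ) (r : ℝ) :
    (convFactor N B n).real {x | r < |x|} =
      ((largeDigits (scaleProd N n * r) (B n)).card : ℝ) / ((B n).card : ℝ) := by
  have hs := scaleProd_pos hN n
  have hinj : Function.Injective fun b => (scaleProd N n)⁻¹ * b :=
    mul_right_injective₀ (inv_ne_zero hs.ne')
  rw [convFactor, uniformDiscrete_real _ _ (measurableSet_lt measurable_const (by fun_prop)),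
    Finset.filter_image, Finset.card_image_of_injective _ hinj,
    Finset.card_image_of_injective _ hinj, largeDigits]
  congr 3
  refine Finset.filter_congr fun b _ => ?_
  rw [abs_mul, abs_of_pos (inv_pos.2 hs), lt_inv_mul_iff₀ hs]

theorem isProbabilityMeasure_convFactor {N : ℕ → ℝ} {B : ℕ → Finset ℝ}
    (hB : ∀ n, 2 ≤ (B n).card) (n : ℕ) : IsProbabilityMeasure (convFactor N B n) :=
  isProbabilityMeasure_uniformDiscrete
    ((Finset.card_pos.1 (two_pos.trans_le (hB n))).image _)

/-! ### The two summability conditions -/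

theorem abs_le_maxAbs {B : Finset ℝ} {b : ℝ} (hb : b ∈ B) : |b| ≤ maxAbs B := by
  have : ‖b‖₊ ≤ B.sup fun b => ‖b‖₊ := Finset.le_sup (f := fun b : ℝ => ‖b‖₊) hb
  simpa [maxAbs] using NNReal.coe_le_coe.2 this

theorem infiniteConvolutionExists_of_summable_largeDigits {N : ℕ → ℝ} {B : ℕ → Finset ℝ}
    (hN : ∀ n, 0 < N n) (hB : ∀ n, 2 ≤ (B n).card) {c : ℕ → ℝ} (hc : Summable c)
    (h : Summable fun n =>
      ((largeDigits (scaleProd N n * c n) (B n)).card : ℝ) / ((B n).card : ℝ)) :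
    InfiniteConvolutionExists N B hB := by
  have := isProbabilityMeasure_convFactor (N := N) hB
  refine exists_tendsto_of_summable_tails (ν := convFactor N B) rfl (fun _ => rfl) hc ?_
  simpa only [convFactor_real_tail hN] using h

theorem infiniteConvolutionExists_of_summable_maxAbs {N : ℕ → ℝ} {B : ℕ → Finset ℝ}
    (hN : ∀ n, 0 < N n) (hB : ∀ n, 2 ≤ (B n).card)
    (h : Summable fun n => maxAbs (B n) / scaleProd N n) : InfiniteConvolutionExists N B hB := by
  refine infiniteConvolutionExists_of_summable_largeDigits hN hB h ?_
  have hempty : ∀ n, largeDigits (scaleProd N n * (maxAbs (B n) / scaleProd N n)) (B n) = ∅ := by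
    intro n
    rw [mul_div_cancel₀ _ (scaleProd_pos hN n).ne', largeDigits, Finset.filter_eq_empty_iff]
    exact fun b hb => (abs_le_maxAbs hb).not_gt
  simp [hempty]

/-- More than half of the digits are main digits, so there are two of them, and the nonzero one is
an integer with `1 ≤ k ≤ M - 1`. -/
theorem two_le_of_card_remainderDigits {M : ℝ} {B : Finset ℝ} (hB : 2 ≤ B.card)
    (h : ((remainderDigits M B).card : ℝ) / (B.card : ℝ) < 1 / 2) : 2 ≤ M := by
  classical
  have hpos : (0 : ℝ) < B.card := by exact_mod_cast two_pos.trans_le hB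
  rw [div_lt_iff₀ hpos] at h
  have hcard := Finset.card_sdiff_add_card_eq_card (s := mainDigits M B) (t := B)
    (Finset.filter_subset _ _)
  have h' : 2 * (remainderDigits M B).card < B.card := by
    have : (2 : ℝ) * (remainderDigits M B).card < B.card := by linarith
    exact_mod_cast this
  have hone : 1 < (mainDigits M B).card := by
    unfold remainderDigits at h'
    omega
  obtain ⟨b, hb, hb0⟩ := Finset.exists_mem_ne hone 0
  rw [mainDigits, Finset.mem_filter] at hb
  obtain ⟨-, k, hk, rfl⟩ := hb
  have hk1 : (1 : ℝ) ≤ k := by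
    exact_mod_cast Nat.one_le_iff_ne_zero.2 fun h => hb0 (by simp [h])
  linarith

/-- Main digits lie in `[0, M - 1]`. -/
theorem largeDigits_subset_remainderDigits (M : ℝ) (B : Finset ℝ) :
    largeDigits M B ⊆ remainderDigits M B := by
  classical
  intro b hb
  obtain ⟨hbB, hM⟩ := Finset.mem_filter.1 hb
  refine Finset.mem_sdiff.2 ⟨hbB, fun hmain => ?_⟩
  rw [mainDigits, Finset.mem_filter] at hmain
  obtain ⟨-, k, hk, rfl⟩ := hmain
  rw [Nat.abs_cast] at hM
  linarith

/-- The remainder bounded condition forces `N n ≥ 2` eventually, so `N n / (N_1 ⋯ N_n)` is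
summable, and only remainder digits are larger than `N n`. -/
theorem infiniteConvolutionExists_of_remainderBounded {N : ℕ → ℝ} {B : ℕ → Finset ℝ}
    (hN : ∀ n, 0 < N n) (hB : ∀ n, 2 ≤ (B n).card) (h : RemainderBounded N B) :
    InfiniteConvolutionExists N B hB := by
  have hN2 : ∀ᶠ n in atTop, 2 ≤ N n := by
    filter_upwards [h.tendsto_atTop_zero.eventually (gt_mem_nhds (by norm_num : (0 : ℝ) < 1 / 2))]
      with n hn using two_le_of_card_remainderDigits (hB n) hn
  have hc : Summable fun n => (scaleProd N n)⁻¹ * N n := by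
    -- the term of index `n + 1` is `(scaleProd N n)⁻¹`
    have hsucc : ∀ n, (scaleProd N (n + 1))⁻¹ * N (n + 1) = (scaleProd N n)⁻¹ := fun n => by
      have := (hN (n + 1)).ne'
      have := (scaleProd_pos hN n).ne'
      rw [scaleProd_succ]
      field_simp
    refine (summable_nat_add_iff 1).1 ?_
    simp_rw [hsucc]
    refine summable_of_ratio_norm_eventually_le (r := 1 / 2) (by norm_num) ?_
    filter_upwards [(tendsto_add_atTop_nat 1).eventually hN2] with n hn
    have hs := scaleProd_pos hN n
    rw [Real.norm_of_nonneg (inv_pos.2 (scaleProd_pos hN _)).le,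
      Real.norm_of_nonneg (inv_pos.2 hs).le, scaleProd_succ, mul_inv, mul_comm]
    gcongr
    rw [one_div]
    exact inv_anti₀ two_pos hn
  refine infiniteConvolutionExists_of_summable_largeDigits hN hB hc ?_
  refine Summable.of_nonneg_of_le (fun n => by positivity) (fun n => ?_) h
  rw [mul_inv_cancel_left₀ (scaleProd_pos hN n).ne']
  gcongr
  exact largeDigits_subset_remainderDigits _ _

theorem theorem2p1 (N : ℕ → ℝ) (B : ℕ → Finset ℝ) (hN : ∀ n, 0 < N n)
    (hB : ∀ n, 2 ≤ (B n).card) :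
    ((RemainderBounded N B ∨ Summable fun n => maxAbs (B n) / scaleProd N n) →
      InfiniteConvolutionExists N B hB) ∧
    ((∃ r₀ : ℝ, 0 < r₀ ∧
        ¬ Summable fun n =>
          ((largeDigits (scaleProd N n * r₀) (B n)).card : ℝ) / ((B n).card : ℝ)) →
      ¬ InfiniteConvolutionExists N B hB) := by
  refine ⟨fun h => h.elim (infiniteConvolutionExists_of_remainderBounded hN hB)
    (infiniteConvolutionExists_of_summable_maxAbs hN hB), ?_⟩
  rintro ⟨r₀, hr₀, hns⟩ ⟨μ', hμ'⟩
  have := isProbabilityMeasure_convFactor (N := N) hB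
  refine hns ?_
  have := summable_tails_of_tendsto (ν := convFactor N B) (μ := partialConvProb N B hB)
    rfl (fun _ => rfl) hμ' hr₀
  simpa only [convFactor_real_tail hN] using this
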